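/- Let $T$ be a tree on $n \ge 3$ vertices with $p$ leaves (vertices of degree $1$), and let $d_{x,y}$ denote the number of edges of the path between the vertices $x$ and $y$ of $T$. Let $\mathrm{Max4PC}_T$ be the real symmetric $\binom{n}{2}\times\binom{n}{2}$ matrix whose rows and columns are indexed by the unordered pairs of distinct vertices of $T$ and whose entry in row $\{w,x\}$ and column $\{y,z\}$ is $$\max\bigl\{d_{w,x}+d_{y,z},\; d_{w,y}+d_{x,z},\; d_{w,z}+d_{x,y}\bigr\}.$$ Let $n_0$, $n_+$, $n_-$ be the numbers of zero, positive and negative eigenvalues of $\mathrm{Max4PC}_T$, counted with multiplicity. Then $$(n_0, n_+, n_-) = \left(\binom{n}{2}-2(n-p),\; n-p,\; n-p\right),$$ and the nullity (dimension of the kernel) of $\mathrm{Max4PC}_T$ is $\binom{n}{2}-2(n-p)$. -/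

import Mathlib

/-- Unordered pairs of distinct elements of `V`. -/
abbrev VertexPair (V : Type*) : Type _ := {e : Sym2 V // ¬ e.IsDiag}

/-- The maximum of `d(w,x) + d(y,z)`, `d(w,y) + d(x,z)` and `d(w,z) + d(x,y)`, where `d` is the
graph distance. -/
noncomputable def fourPointMax {V : Type*} (T : SimpleGraph V) (w x y z : V) : ℕ :=
  max (T.dist w x + T.dist y z) (max (T.dist w y + T.dist x z) (T.dist w z + T.dist x y))

theorem fourPointMax_swap_left {V : Type*} (T : SimpleGraph V) (w x y z : V) :
    fourPointMax T w x y z = fourPointMax T x w y z := by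
  simp only [fourPointMax, T.dist_comm (u := w) (v := x)]
  rw [max_comm (T.dist w y + _), add_comm (T.dist w z), add_comm (T.dist w y)]

theorem fourPointMax_swap_right {V : Type*} (T : SimpleGraph V) (w x y z : V) :
    fourPointMax T w x y z = fourPointMax T w x z y := by
  simp only [fourPointMax, T.dist_comm (u := y) (v := z)]
  rw [max_comm (T.dist w y + _)]

theorem fourPointMax_comm {V : Type*} (T : SimpleGraph V) (w x y z : V) :
    fourPointMax T w x y z = fourPointMax T y z w x := by
  simp only [fourPointMax, T.dist_comm (u := y) (v := w), T.dist_comm (u := z) (v := x),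
    T.dist_comm (u := y) (v := x), T.dist_comm (u := z) (v := w)]
  rw [add_comm (T.dist w x), add_comm (T.dist w z)]

/-- `fourPointMax` as a function of the two unordered pairs `{w, x}` and `{y, z}`. -/
noncomputable def fourPointMaxSym {V : Type*} (T : SimpleGraph V) : Sym2 V → Sym2 V → ℕ :=
  Sym2.lift₂ ⟨fourPointMax T, fun w x y z =>
    ⟨fourPointMax_swap_left T w x y z, fourPointMax_swap_right T w x y z⟩⟩

theorem fourPointMaxSym_mk {V : Type*} (T : SimpleGraph V) (w x y z : V) :
    fourPointMaxSym T s(w, x) s(y, z) = fourPointMax T w x y z := rfl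

/-- The maximum four-point-condition matrix of `T`, with rows and columns indexed by the unordered
pairs of distinct vertices. -/
noncomputable def Max4PC {V : Type*} (T : SimpleGraph V) :
    Matrix (VertexPair V) (VertexPair V) ℝ :=
  Matrix.of fun e f => (fourPointMaxSym T e.1 f.1 : ℝ)

theorem Max4PC_isHermitian {V : Type*} (T : SimpleGraph V) : (Max4PC T).IsHermitian := by
  ext ⟨e, he⟩ ⟨f, hf⟩
  induction e using Sym2.ind with | _ w x
  induction f using Sym2.ind with | _ y z
  simp [Max4PC, fourPointMaxSym_mk, fourPointMax_comm T y z w x]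

/-- The inertia `(n₀, n₊, n₋)` of a real symmetric matrix: the numbers of zero, positive and
negative eigenvalues, counted with multiplicity. -/
noncomputable def inertia {ι : Type*} [Fintype ι] [DecidableEq ι] {A : Matrix ι ι ℝ}
    (hA : A.IsHermitian) : ℕ × ℕ × ℕ :=
  ((Finset.univ.filter fun i => hA.eigenvalues i = 0).card,
    (Finset.univ.filter fun i => 0 < hA.eigenvalues i).card,
    (Finset.univ.filter fun i => hA.eigenvalues i < 0).card)

/-- The number of leaves (vertices of degree one) of a finite graph. -/
def numLeaves {V : Type*} [Fintype V] (T : SimpleGraph V) [DecidableRel T.Adj] : ℕ :=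
  (Finset.univ.filter fun v => T.degree v = 1).card

/-!
Root the tree at a vertex `r` which is not a leaf, and let `I x` be the set of ancestors of `x`.
Then `d(x, y) = |I x| + |I y| - 2 |I x ∩ I y|`, so the maximum of the three sums of distances
corresponds to the minimum of the three sums `|I w ∩ I x| + |I y ∩ I z|`. Ancestor sets are chains:
two of the intersections `I x ∩ I y`, `I x ∩ I z` are always comparable, and this forces the minimum
to be the value
`|I w ∩ I x ∩ (I y ∪ I z)| + |(I w ∪ I x) ∩ I y ∩ I z|`,
which separates the pairs `{w, x}` and `{y, z}`. Expanding these cardinalities over the vertices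
writes the matrix as a sum `∑ v, (p v (q v)ᵀ + q v (p v)ᵀ)`, where `p v` is the indicator vector of
the pairs below `v`. A leaf is not a common ancestor of two distinct vertices, so only the `n - p`
other vertices contribute. Their vectors are linearly independent, hence each of them contributes a
hyperbolic plane, with one positive and one negative direction, and Sylvester's law of inertia
concludes.
-/

open Matrix Module

section Signature

variable {𝕜 M ι : Type*} [Field 𝕜] [LinearOrder 𝕜] [AddCommGroup M] [Module 𝕜 M]
  [FiniteDimensional 𝕜 M] [Fintype ι]

theorem sigPos_le_card_of_nonpos_of_dual_eq_zero {Q : QuadraticForm 𝕜 M} (φ : ι → Dual 𝕜 M)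
    (hQ : ∀ x, (∀ i, φ i x = 0) → Q x ≤ 0) : sigPos Q ≤ Fintype.card ι := by
  let W : Subspace 𝕜 (Dual 𝕜 M) := Submodule.span 𝕜 (Set.range φ)
  have hW : ∀ x ∈ W.dualCoannihilator, Q x ≤ 0 := fun x hx =>
    hQ x fun i => (Submodule.mem_dualCoannihilator x).1 hx _ (Submodule.subset_span ⟨i, rfl⟩)
  have hle := QuadraticForm.sigPos_add_finrank_le_of_nonpos hW
  have hdim := Subspace.finrank_add_finrank_dualCoannihilator_eq W
  have hcard : finrank 𝕜 W ≤ Fintype.card ι := finrank_range_le_card φ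
  lia

variable [IsStrictOrderedRing 𝕜] {B : LinearMap.BilinForm 𝕜 M} {p q : ι → Dual 𝕜 M}

theorem finrank_radical_add_two_mul_card_le (hpq : LinearIndependent 𝕜 (Sum.elim p q))
    (hB : ∀ x y, B x y = ∑ i, (p i x * q i y + q i x * p i y)) :
    finrank 𝕜 B.toQuadraticMap.radical + 2 * Fintype.card ι ≤ finrank 𝕜 M := by
  let W : Subspace 𝕜 (Dual 𝕜 M) := Submodule.span 𝕜 (Set.range (Sum.elim p q))
  have hW : finrank 𝕜 W = 2 * Fintype.card ι := by
    rw [finrank_span_eq_card hpq, Fintype.card_sum, two_mul]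
  have hrad : B.toQuadraticMap.radical ≤ W.dualCoannihilator := by
    intro x hx
    have hpolar : ∀ y, B x y + B y x = 0 := fun y => by
      rw [← LinearMap.BilinMap.polar_toQuadraticMap]
      exact LinearMap.congr_fun (QuadraticMap.radical_le_ker_polarBilin hx) y
    have hcomb : ∑ j, Sum.elim (fun i => q i x) (fun i => p i x) j • Sum.elim p q j = 0 := by
      ext y
      have hsum := hpolar y
      rw [hB, hB, ← Finset.sum_add_distrib] at hsum
      have : 2 * ∑ i, (p i x * q i y + q i x * p i y) = 0 := by
        rw [← hsum, Finset.mul_sum]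
        exact Finset.sum_congr rfl fun i _ => by ring
      simpa [Finset.sum_add_distrib, add_comm] using this
    have hzero := Fintype.linearIndependent_iff.1 hpq _ hcomb
    rw [← SetLike.mem_coe, Submodule.coe_dualCoannihilator_span]
    rintro _ ⟨i | i, rfl⟩
    exacts [hzero (.inr i), hzero (.inl i)]
  have hle := Submodule.finrank_mono hrad
  have hdim := Subspace.finrank_add_finrank_dualCoannihilator_eq W
  lia

/-- Each summand `p i ⊗ q i + q i ⊗ p i` is nonpositive where `p i + q i` vanishes and nonnegative
where `p i - q i` vanishes. -/
theorem sigPos_eq_card_and_sigNeg_eq_card (hpq : LinearIndependent 𝕜 (Sum.elim p q))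
    (hB : ∀ x y, B x y = ∑ i, (p i x * q i y + q i x * p i y)) :
    sigPos B.toQuadraticMap = Fintype.card ι ∧ sigNeg B.toQuadraticMap = Fintype.card ι := by
  have hpos : sigPos B.toQuadraticMap ≤ Fintype.card ι := by
    refine sigPos_le_card_of_nonpos_of_dual_eq_zero (fun i => p i + q i) fun x hx => ?_
    rw [LinearMap.BilinMap.toQuadraticMap_apply, hB]
    refine Finset.sum_nonpos fun i _ => ?_
    rw [eq_neg_of_add_eq_zero_left (hx i)]
    nlinarith [mul_self_nonneg (q i x)]
  have hneg : sigNeg B.toQuadraticMap ≤ Fintype.card ι := by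
    refine sigPos_le_card_of_nonpos_of_dual_eq_zero (fun i => p i - q i) fun x hx => ?_
    rw [_root_.neg_apply, LinearMap.BilinMap.toQuadraticMap_apply, hB, neg_nonpos]
    refine Finset.sum_nonneg fun i _ => ?_
    rw [sub_eq_zero.1 (hx i)]
    nlinarith [mul_self_nonneg (q i x)]
  have hrad := finrank_radical_add_two_mul_card_le hpq hB
  have hsum := QuadraticForm.sigPos_add_sigNeg_add_radical (Q := B.toQuadraticMap)
  lia

end Signature

section Inertia

variable {P : Type*} [Fintype P] [DecidableEq P] {A : Matrix P P ℝ}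

theorem equivalent_weightedSumSquares_eigenvalues (hA : A.IsHermitian) :
    (toBilin' A).toQuadraticMap.Equivalent
      (QuadraticMap.weightedSumSquares ℝ hA.eigenvalues) := by
  let b : Basis P ℝ (P → ℝ) :=
    hA.eigenvectorBasis.toBasis.map (WithLp.linearEquiv 2 ℝ (P → ℝ))
  have hB : ∀ i j, toBilin' A (b i) (b j) = if i = j then hA.eigenvalues j else 0 := by
    intro i j
    have hb : ∀ i, b i = (hA.eigenvectorBasis i).ofLp := fun i => by simp [b]
    rw [toBilin'_apply', hb, hb, hA.mulVec_eigenvectorBasis, dotProduct_smul, ← star_trivial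
      (hA.eigenvectorBasis i).ofLp, dotProduct_comm, ← EuclideanSpace.inner_eq_star_dotProduct]
    simp [orthonormal_iff_ite.1 hA.eigenvectorBasis.orthonormal]
  have hortho : LinearMap.IsOrthoᵢ (QuadraticMap.associated (toBilin' A).toQuadraticMap) b := by
    intro i j hij
    change QuadraticMap.associated _ (b i) (b j) = 0
    simp [QuadraticMap.associated_apply, hB, hij, hij.symm]
  have hrepr := QuadraticMap.basisRepr_eq_of_iIsOrtho _ b hortho
  simp only [LinearMap.BilinMap.toQuadraticMap_apply, hB, if_true] at hrepr
  exact ⟨hrepr ▸ QuadraticMap.isometryEquivBasisRepr _ b⟩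

theorem inertia_eq_finrank_ker_sigPos_sigNeg (hA : A.IsHermitian) :
    inertia hA = (finrank ℝ (LinearMap.ker A.mulVecLin), sigPos (toBilin' A).toQuadraticMap,
      sigNeg (toBilin' A).toQuadraticMap) := by
  have e := equivalent_weightedSumSquares_eigenvalues hA
  have hker : finrank ℝ (LinearMap.ker A.mulVecLin) =
      (Finset.univ.filter fun i => hA.eigenvalues i = 0).card := by
    have hrank := hA.rank_eq_card_non_zero_eigs
    have hdim := A.mulVecLin.finrank_range_add_finrank_ker
    have hcompl := Finset.card_filter_add_card_filter_not (s := .univ) (hA.eigenvalues · = 0)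
    rw [Fintype.card_subtype, Matrix.rank] at hrank
    rw [finrank_fintype_fun_eq_card] at hdim
    rw [Finset.card_univ] at hcompl
    lia
  rw [QuadraticForm.sigPos_of_equiv_weightedSumSquares e,
    QuadraticForm.sigNeg_of_equiv_weightedSumSquares e, hker]
  simp [inertia, Set.ncard_eq_toFinset_card']

theorem inertia_add_eq_card (hA : A.IsHermitian) :
    (inertia hA).1 + (inertia hA).2.1 + (inertia hA).2.2 = Fintype.card P := by
  simp only [inertia, Finset.card_filter, ← Finset.sum_add_distrib, Fintype.card_eq_sum_ones]
  refine Finset.sum_congr rfl fun i _ => ?_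
  grind

theorem inertia_of_eq_sum_vecMulVec {ι : Type*} [Fintype ι] (hA : A.IsHermitian)
    {p q : ι → P → ℝ} (hpq : LinearIndependent ℝ (Sum.elim p q))
    (hsum : A = ∑ i, (vecMulVec (p i) (q i) + vecMulVec (q i) (p i))) :
    inertia hA = (Fintype.card P - 2 * Fintype.card ι, Fintype.card ι, Fintype.card ι) := by
  have hdual : LinearIndependent ℝ
      (Sum.elim (fun i => dotProductEquiv ℝ P (p i)) fun i => dotProductEquiv ℝ P (q i)) := by
    have hcomp := hpq.map' (dotProductEquiv ℝ P).toLinearMap (LinearEquiv.ker _)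
    rwa [Sum.comp_elim] at hcomp
  have hB : ∀ x y, toBilin' A x y =
      ∑ i, (dotProductEquiv ℝ P (p i) x * dotProductEquiv ℝ P (q i) y +
        dotProductEquiv ℝ P (q i) x * dotProductEquiv ℝ P (p i) y) := by
    intro x y
    simp [toBilin'_apply', hsum, vecMulVec_mulVec, dotProduct_comm, mul_comm]
  obtain ⟨hpos, hneg⟩ := sigPos_eq_card_and_sigNeg_eq_card hdual hB
  have hinertia := inertia_eq_finrank_ker_sigPos_sigNeg hA
  have hcard := inertia_add_eq_card hA
  rw [hinertia, hpos, hneg] at hcard ⊢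
  congr 1
  lia

end Inertia

section FourPoint

variable {α V : Type*} [DecidableEq α]

/-- The number of elements of at least three of the sets `W`, `X`, `Y`, `Z`, the elements of all
four counted twice. It is symmetric in the four sets. -/
def crossCard (W X Y Z : Finset α) : ℕ :=
  (W ∩ X ∩ (Y ∪ Z)).card + ((W ∪ X) ∩ (Y ∩ Z)).card

theorem crossCard_comm_right (W X Y Z : Finset α) : crossCard W X Y Z = crossCard W X Z Y := by
  rw [crossCard, crossCard, Finset.union_comm Y, Finset.inter_comm Y]

theorem crossCard_swap (W X Y Z : Finset α) : crossCard W X Y Z = crossCard W Y X Z := by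
  rw [crossCard, crossCard, ← Finset.card_union_add_card_inter,
    ← Finset.card_union_add_card_inter (W ∩ Y ∩ (X ∪ Z))]
  congr 2 <;> ext <;> simp only [Finset.mem_union, Finset.mem_inter] <;> tauto

theorem card_inter_add_card_inter (W X Y Z : Finset α) :
    (W ∩ X).card + (Y ∩ Z).card =
      crossCard W X Y Z + (((W ∩ X) \ (Y ∪ Z)).card + ((Y ∩ Z) \ (W ∪ X)).card) := by
  rw [crossCard, ← Finset.card_inter_add_card_sdiff (W ∩ X) (Y ∪ Z),
    ← Finset.card_inter_add_card_sdiff (Y ∩ Z) (W ∪ X), Finset.inter_comm (Y ∩ Z)]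
  exact add_add_add_comm ..

theorem min_card_inter_add_card_inter {I : V → Finset α}
    (hI : ∀ x y z, I x ∩ I y ⊆ I z ∨ I x ∩ I z ⊆ I y) (w x y z : V) :
    min ((I w ∩ I x).card + (I y ∩ I z).card)
      (min ((I w ∩ I y).card + (I x ∩ I z).card) ((I w ∩ I z).card + (I x ∩ I y).card)) =
      crossCard (I w) (I x) (I y) (I z) := by
  have hnested : ∀ a b c d, (I a ∩ I b) \ (I c ∪ I d) = ∅ ∨ (I a ∩ I c) \ (I b ∪ I d) = ∅ := by
    intro a b c d
    simp only [Finset.sdiff_eq_empty_iff_subset]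
    exact (hI a b c).imp (·.trans Finset.subset_union_left) (·.trans Finset.subset_union_left)
  have h₁ := card_inter_add_card_inter (I w) (I x) (I y) (I z)
  have h₂ := card_inter_add_card_inter (I w) (I y) (I x) (I z)
  have h₃ := card_inter_add_card_inter (I w) (I z) (I x) (I y)
  rw [← crossCard_swap] at h₂
  rw [← crossCard_swap, ← crossCard_comm_right] at h₃
  suffices (I w ∩ I x) \ (I y ∪ I z) = ∅ ∧ (I y ∩ I z) \ (I w ∪ I x) = ∅ ∨
      (I w ∩ I y) \ (I x ∪ I z) = ∅ ∧ (I x ∩ I z) \ (I w ∪ I y) = ∅ by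
    rcases this with ⟨h, h'⟩ | ⟨h, h'⟩ <;> simp only [h, h', Finset.card_empty] at h₁ h₂ <;> lia
  have hw := hnested w x y z
  have hx := hnested x w z y
  have hy := hnested y z w x
  have hz := hnested z y x w
  simp only [Finset.inter_comm (I x) (I w), Finset.inter_comm (I z) (I y),
    Finset.inter_comm (I z) (I x), Finset.inter_comm (I y) (I w), Finset.union_comm (I z) (I y),
    Finset.union_comm (I z) (I x), Finset.union_comm (I x) (I w),
    Finset.union_comm (I y) (I w)] at hw hx hy hz
  tauto

end FourPoint

section IsParent

variable {V : Type*} {T : SimpleGraph V} {r p q x y : V}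

/-- In the tree `T` rooted at `r`, the vertex `p` is the parent of `y`: it is the neighbour of `y`
which is closer to the root. -/
def IsParent (T : SimpleGraph V) (r p y : V) : Prop :=
  T.Adj p y ∧ T.dist r y = T.dist r p + 1

theorem IsParent.ne_root (h : IsParent T r p y) : y ≠ r := by
  rintro rfl
  simpa using h.2

theorem exists_isParent (hT : T.Connected) (hy : y ≠ r) : ∃ p, IsParent T r p y := by
  obtain ⟨c, hc⟩ := hT.exists_walk_length_eq_dist y r
  cases c with
  | nil => exact absurd rfl hy
  | @cons _ p _ hadj c =>
    refine ⟨p, hadj.symm, ?_⟩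
    have hle := SimpleGraph.dist_le c
    have htri := hT.dist_triangle (u := y) (v := p) (w := r)
    rw [SimpleGraph.dist_eq_one_iff_adj.2 hadj] at htri
    rw [SimpleGraph.Walk.length_cons] at hc
    rw [SimpleGraph.dist_comm, SimpleGraph.dist_comm (v := p)]
    lia

theorem isParent_or_isParent_of_adj (hT : T.IsTree) (r : V) (hxy : T.Adj x y) :
    IsParent T r x y ∨ IsParent T r y x :=
  (hT.dist_eq_dist_add_one_of_adj r hxy).symm.imp (⟨hxy, ·⟩) (⟨hxy.symm, ·⟩)

/-- Prolonging geodesics from `r` to `p` and to `q` by the edges to `y` gives two paths. -/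
theorem IsParent.unique (hT : T.IsTree) (hp : IsParent T r p y) (hq : IsParent T r q y) :
    p = q := by
  obtain ⟨c, hc⟩ := hT.connected.exists_walk_length_eq_dist r p
  obtain ⟨d, hd⟩ := hT.connected.exists_walk_length_eq_dist r q
  have hcpath : (c.concat hp.1).IsPath :=
    SimpleGraph.Walk.isPath_of_length_eq_dist _ (by rw [SimpleGraph.Walk.length_concat, hc, hp.2])
  have hdpath : (d.concat hq.1).IsPath :=
    SimpleGraph.Walk.isPath_of_length_eq_dist _ (by rw [SimpleGraph.Walk.length_concat, hd, hq.2])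
  have heq : c.concat hp.1 = d.concat hq.1 := congrArg Subtype.val
    ((hT.isAcyclic.subsingleton_path r y).elim ⟨_, hcpath⟩ ⟨_, hdpath⟩)
  simpa using congrArg SimpleGraph.Walk.penultimate heq

@[elab_as_elim]
theorem IsParent.induction (hT : T.Connected) {motive : V → Prop} (root : motive r)
    (child : ∀ p y, IsParent T r p y → motive p → motive y) (y : V) : motive y := by
  induction hd : T.dist r y generalizing y with
  | zero => exact hT.dist_eq_zero_iff.1 hd ▸ root
  | succ d ih =>
    obtain ⟨p, hp⟩ := exists_isParent hT (r := r) (y := y) (by rintro rfl; simp at hd)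
    exact child p y hp (ih p (by rwa [hp.2, Nat.add_right_cancel_iff] at hd))

end IsParent

section Ancestors

variable {V : Type*} [Fintype V] {T : SimpleGraph V} {r p v x y : V}

/-- The vertices on the path from `r` to `x`: in the tree `T` rooted at `r`, these are the
ancestors of `x`, both the root and `x` itself included. -/
noncomputable def ancestors (T : SimpleGraph V) (r x : V) : Finset V :=
  {v | T.dist r v + T.dist v x = T.dist r x}

theorem mem_ancestors : v ∈ ancestors T r x ↔ T.dist r v + T.dist v x = T.dist r x := by
  simp [ancestors]

theorem self_mem_ancestors : x ∈ ancestors T r x := by simp [mem_ancestors]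

theorem root_mem_ancestors : r ∈ ancestors T r x := by simp [mem_ancestors]

theorem ancestors_root (hT : T.Connected) : ancestors T r r = {r} := by
  ext v
  simp [mem_ancestors, hT.dist_eq_zero_iff, eq_comm]

theorem ancestors_subset (hT : T.Connected) (hv : v ∈ ancestors T r x) :
    ancestors T r v ⊆ ancestors T r x := by
  intro u hu
  rw [mem_ancestors] at hu hv ⊢
  have h₁ := hT.dist_triangle (u := u) (v := v) (w := x)
  have h₂ := hT.dist_triangle (u := r) (v := u) (w := x)
  lia

theorem IsParent.notMem_ancestors (h : IsParent T r p y) : y ∉ ancestors T r p := by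
  rw [mem_ancestors, h.2]
  lia

theorem IsParent.ancestors_eq_insert [DecidableEq V] (hT : T.IsTree) (h : IsParent T r p y) :
    ancestors T r y = insert y (ancestors T r p) := by
  have hp : p ∈ ancestors T r y := by
    rw [mem_ancestors, SimpleGraph.dist_eq_one_iff_adj.2 h.1, h.2]
  refine (Finset.insert_subset self_mem_ancestors
    (ancestors_subset hT.connected hp)).antisymm' fun v hv => Finset.mem_insert.2 ?_
  refine or_iff_not_imp_left.2 fun hvy => ?_
  rw [mem_ancestors] at hv
  -- The vertex before `y` on the path from `v` to `y` is also a parent of `y`.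
  obtain ⟨q, hvq⟩ := exists_isParent hT.connected (r := v) (y := y) (Ne.symm hvy)
  have hdist := hvq.2
  have hrq : IsParent T r q y := by
    refine ⟨hvq.1, ?_⟩
    have h₁ := hT.connected.dist_triangle (u := r) (v := v) (w := q)
    have h₂ := hT.connected.dist_triangle (u := r) (v := q) (w := y)
    rw [SimpleGraph.dist_eq_one_iff_adj.2 hvq.1] at h₂
    lia
  obtain rfl := hrq.unique hT h
  rw [mem_ancestors]
  have := hrq.2
  lia

theorem inter_ancestors_subset_or [DecidableEq V] (hT : T.IsTree) (r x y z : V) :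
    ancestors T r x ∩ ancestors T r y ⊆ ancestors T r z ∨
      ancestors T r x ∩ ancestors T r z ⊆ ancestors T r y := by
  induction x using IsParent.induction hT.connected (r := r) with
  | root =>
    rw [ancestors_root hT.connected]
    exact .inl (Finset.inter_subset_left.trans (Finset.singleton_subset_iff.2 root_mem_ancestors))
  | child p x hp ih =>
    by_cases hy : x ∈ ancestors T r y
    · exact .inr (Finset.inter_subset_left.trans (ancestors_subset hT.connected hy))
    by_cases hz : x ∈ ancestors T r z
    · exact .inl (Finset.inter_subset_left.trans (ancestors_subset hT.connected hz))
    rwa [hp.ancestors_eq_insert hT, Finset.insert_inter_of_notMem hy,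
      Finset.insert_inter_of_notMem hz]

theorem IsParent.card_ancestors (hT : T.IsTree) (h : IsParent T r p y) :
    (ancestors T r y).card = (ancestors T r p).card + 1 := by
  classical rw [h.ancestors_eq_insert hT, Finset.card_insert_of_notMem h.notMem_ancestors]

theorem card_ancestors_eq_dist_add_one (hT : T.IsTree) (r x : V) :
    (ancestors T r x).card = T.dist r x + 1 := by
  induction x using IsParent.induction hT.connected (r := r) with
  | root => rw [ancestors_root hT.connected, Finset.card_singleton, SimpleGraph.dist_self]
  | child p x hp ih => rw [hp.card_ancestors hT, ih, hp.2]

theorem dist_add_two_mul_card_inter_ancestors_le [DecidableEq V] (hT : T.IsTree) (r x y : V) :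
    T.dist x y + 2 * (ancestors T r x ∩ ancestors T r y).card ≤
      (ancestors T r x).card + (ancestors T r y).card := by
  have hmem : ∀ x ∈ ancestors T r y,
      T.dist x y + 2 * (ancestors T r x ∩ ancestors T r y).card ≤
        (ancestors T r x).card + (ancestors T r y).card := by
    intro x hx
    rw [Finset.inter_eq_left.2 (ancestors_subset hT.connected hx),
      card_ancestors_eq_dist_add_one hT, card_ancestors_eq_dist_add_one hT]
    have := mem_ancestors.1 hx
    lia
  induction x using IsParent.induction hT.connected (r := r) with
  | root => exact hmem r root_mem_ancestors
  | child p x hp ih =>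
    by_cases hx : x ∈ ancestors T r y
    · exact hmem x hx
    have htri := hT.connected.dist_triangle (u := x) (v := p) (w := y)
    rw [SimpleGraph.dist_eq_one_iff_adj.2 hp.1.symm] at htri
    rw [hp.card_ancestors hT, hp.ancestors_eq_insert hT, Finset.insert_inter_of_notMem hx]
    lia

theorem card_ancestors_add_card_ancestors_le [DecidableEq V] (hT : T.IsTree) (r x y : V) :
    (ancestors T r x).card + (ancestors T r y).card ≤
      T.dist x y + 2 * (ancestors T r x ∩ ancestors T r y).card := by
  induction y using IsParent.induction hT.connected (r := x) with
  | root => rw [Finset.inter_self, two_mul]; exact le_add_self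
  | child z y hz ih =>
    rw [hz.2]
    obtain h | h := isParent_or_isParent_of_adj hT r hz.1
    · have hmono : (ancestors T r x ∩ ancestors T r z).card ≤
          (ancestors T r x ∩ ancestors T r y).card := by
        rw [h.ancestors_eq_insert hT]
        gcongr
        exact Finset.subset_insert ..
      have := h.card_ancestors hT
      lia
    · have hinsert : (ancestors T r x ∩ ancestors T r z).card ≤
          (ancestors T r x ∩ ancestors T r y).card + 1 := by
        rw [h.ancestors_eq_insert hT]
        refine (Finset.card_le_card ?_).trans (Finset.card_insert_le z _)
        rw [Finset.insert_inter_distrib]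
        exact Finset.inter_subset_inter_right (Finset.subset_insert ..)
      have := h.card_ancestors hT
      lia

theorem dist_add_two_mul_card_inter_ancestors [DecidableEq V] (hT : T.IsTree) (r x y : V) :
    T.dist x y + 2 * (ancestors T r x ∩ ancestors T r y).card =
      (ancestors T r x).card + (ancestors T r y).card :=
  (dist_add_two_mul_card_inter_ancestors_le hT r x y).antisymm
    (card_ancestors_add_card_ancestors_le hT r x y)

end Ancestors

section Leaves

variable {V : Type*} [Fintype V] {T : SimpleGraph V} [DecidableRel T.Adj] {r p v x y : V}

theorem exists_ne_adj_of_degree_ne_one [Nontrivial V] (hT : T.Connected) (hv : T.degree v ≠ 1) :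
    ∃ x y, x ≠ y ∧ T.Adj v x ∧ T.Adj v y := by
  have hpos := hT.preconnected.degree_pos_of_nontrivial v
  obtain ⟨x, hx, y, hy, hxy⟩ := Finset.one_lt_card.1
    ((T.card_neighborFinset_eq_degree v).symm ▸ (by lia : 1 < T.degree v))
  exact ⟨x, y, hxy, (T.mem_neighborFinset v x).1 hx, (T.mem_neighborFinset v y).1 hy⟩

theorem exists_ne_isParent_root [Nontrivial V] (hT : T.IsTree) (hr : T.degree r ≠ 1) :
    ∃ x y, x ≠ y ∧ IsParent T r r x ∧ IsParent T r r y := by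
  obtain ⟨x, y, hxy, hx, hy⟩ := exists_ne_adj_of_degree_ne_one hT.connected hr
  exact ⟨x, y, hxy, (isParent_or_isParent_of_adj hT r hx).resolve_right (·.ne_root rfl),
    (isParent_or_isParent_of_adj hT r hy).resolve_right (·.ne_root rfl)⟩

theorem exists_isParent_of_degree_ne_one [Nontrivial V] (hT : T.IsTree) (hv : T.degree v ≠ 1)
    (r : V) : ∃ x, IsParent T r v x := by
  obtain ⟨x, y, hxy, hx, hy⟩ := exists_ne_adj_of_degree_ne_one hT.connected hv
  obtain hx | hx := isParent_or_isParent_of_adj hT r hx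
  · exact ⟨x, hx⟩
  obtain hy | hy := isParent_or_isParent_of_adj hT r hy
  · exact ⟨y, hy⟩
  exact absurd (hx.unique hT hy) hxy

theorem IsParent.degree_ne_one (hT : T.Connected) (h : IsParent T r p y) (hp : p ≠ r) :
    T.degree p ≠ 1 := by
  obtain ⟨q, hq⟩ := exists_isParent hT hp
  rw [Ne, SimpleGraph.degree_eq_one_iff_existsUnique_adj]
  intro hunique
  obtain rfl := hunique.unique h.1 hq.1.symm
  have h₁ := h.2
  have h₂ := hq.2
  lia

theorem eq_of_mem_ancestors_of_degree_eq_one (hT : T.IsTree) (hv : T.degree v = 1) (hvr : v ≠ r)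
    (hvx : v ∈ ancestors T r x) : v = x := by
  classical
  induction x using IsParent.induction hT.connected (r := r) with
  | root => rwa [ancestors_root hT.connected, Finset.mem_singleton] at hvx
  | child p x hp ih =>
    rw [hp.ancestors_eq_insert hT, Finset.mem_insert] at hvx
    refine hvx.resolve_right fun h => ?_
    obtain rfl := ih h
    exact hp.degree_ne_one hT.connected hvr hv

theorem exists_degree_ne_one (hT : T.IsTree) (hV : Fintype.card V ≠ 2) : ∃ r, T.degree r ≠ 1 := by
  by_contra! hleaf
  have hsum := T.sum_degrees_eq_twice_card_edges
  have hedge := hT.card_edgeFinset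
  simp only [hleaf, Finset.sum_const, Finset.card_univ, smul_eq_mul] at hsum
  lia

end Leaves

section Pairs

variable {V : Type*} [Fintype V] [DecidableEq V] {T : SimpleGraph V} {r v x y : V}

/-- The common ancestors of the two vertices of the pair `e` in the tree `T` rooted at `r`. -/
noncomputable def pairMeet (T : SimpleGraph V) (r : V) (e : Sym2 V) : Finset V :=
  (e.map (ancestors T r)).inf

/-- The ancestors of either vertex of the pair `e` in the tree `T` rooted at `r`. -/
noncomputable def pairJoin (T : SimpleGraph V) (r : V) (e : Sym2 V) : Finset V :=
  (e.map (ancestors T r)).sup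

theorem pairMeet_mk : pairMeet T r s(x, y) = ancestors T r x ∩ ancestors T r y := rfl

theorem pairJoin_mk : pairJoin T r s(x, y) = ancestors T r x ∪ ancestors T r y := rfl

theorem root_mem_pairMeet (e : Sym2 V) : r ∈ pairMeet T r e := by
  induction e using Sym2.ind with | _ x y
  rw [pairMeet_mk]
  exact Finset.mem_inter.2 ⟨root_mem_ancestors, root_mem_ancestors⟩

theorem notMem_pairMeet_of_degree_eq_one [DecidableRel T.Adj] (hT : T.IsTree)
    (hv : T.degree v = 1) (hvr : v ≠ r) {e : Sym2 V} (he : ¬ e.IsDiag) : v ∉ pairMeet T r e := by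
  induction e using Sym2.ind with | _ x y
  rw [pairMeet_mk, Finset.mem_inter]
  rintro ⟨hx, hy⟩
  exact he ((eq_of_mem_ancestors_of_degree_eq_one hT hv hvr hx).symm.trans
    (eq_of_mem_ancestors_of_degree_eq_one hT hv hvr hy))

theorem fourPointMaxSym_add_two_mul (hT : T.IsTree) (r : V) (e f : Sym2 V) :
    fourPointMaxSym T e f +
        2 * ((pairMeet T r e ∩ pairJoin T r f).card + (pairJoin T r e ∩ pairMeet T r f).card) =
      (pairMeet T r e).card + (pairJoin T r e).card +
        ((pairMeet T r f).card + (pairJoin T r f).card) := by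
  induction e using Sym2.ind with | _ w x
  induction f using Sym2.ind with | _ y z
  simp only [fourPointMaxSym_mk, fourPointMax, pairMeet_mk, pairJoin_mk,
    Finset.card_inter_add_card_union]
  have hmin := min_card_inter_add_card_inter (inter_ancestors_subset_or hT r) w x y z
  rw [crossCard] at hmin
  have hdist := dist_add_two_mul_card_inter_ancestors hT r
  have := hdist w x
  have := hdist w y
  have := hdist w z
  have := hdist x y
  have := hdist x z
  have := hdist y z
  lia

/-- The indicator vector of the pairs having `v` as a common ancestor. -/
noncomputable def meetVec (T : SimpleGraph V) (r v : V) (e : VertexPair V) : ℝ :=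
  if v ∈ pairMeet T r e then 1 else 0

/-- The vector paired with `meetVec T r v` in the decomposition of `Max4PC T`. The ancestor counts
of a pair enter with the root only, because the root is a common ancestor of every pair. -/
noncomputable def joinVec (T : SimpleGraph V) (r v : V) (e : VertexPair V) : ℝ :=
  (if v = r then ((pairMeet T r e).card + (pairJoin T r e).card : ℝ) else 0) -
    2 * if v ∈ pairJoin T r e then 1 else 0

theorem sum_mul_meetVec (α : V → ℝ) (e : VertexPair V) :
    ∑ v, α v * meetVec T r v e = ∑ v ∈ pairMeet T r e, α v := by
  simp [meetVec]

theorem sum_mul_joinVec (β : V → ℝ) (e : VertexPair V) :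
    ∑ v, β v * joinVec T r v e = β r * ((pairMeet T r e).card + (pairJoin T r e).card) -
      2 * ∑ v ∈ pairJoin T r e, β v := by
  simp [joinVec, mul_sub, Finset.sum_mul, mul_comm]

theorem sum_meetVec_mul_joinVec (e f : VertexPair V) :
    ∑ v, meetVec T r v e * joinVec T r v f =
      (pairMeet T r f).card + (pairJoin T r f).card -
        2 * (pairMeet T r e ∩ pairJoin T r f).card := by
  rw [sum_mul_joinVec]
  simp [meetVec, root_mem_pairMeet, Finset.inter_comm]

theorem meetVec_eq_zero_of_degree_eq_one [DecidableRel T.Adj] (hT : T.IsTree)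
    (hv : T.degree v = 1) (hvr : v ≠ r) : meetVec T r v = 0 :=
  funext fun e => if_neg (notMem_pairMeet_of_degree_eq_one hT hv hvr e.2)

theorem Max4PC_eq_sum_vecMulVec [DecidableRel T.Adj] (hT : T.IsTree) (hr : T.degree r ≠ 1) :
    Max4PC T = ∑ v : {v // T.degree v ≠ 1},
      (vecMulVec (meetVec T r v) (joinVec T r v) + vecMulVec (joinVec T r v) (meetVec T r v)) := by
  have hall : Max4PC T = ∑ v,
      (vecMulVec (meetVec T r v) (joinVec T r v) + vecMulVec (joinVec T r v) (meetVec T r v)) := by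
    ext e f
    have hmax := congrArg (Nat.cast (R := ℝ)) (fourPointMaxSym_add_two_mul hT r e f)
    push_cast at hmax
    have hef := sum_meetVec_mul_joinVec (T := T) (r := r) e f
    have hfe := sum_meetVec_mul_joinVec (T := T) (r := r) f e
    simp only [mul_comm (meetVec T r _ f), Finset.inter_comm (pairMeet T r f)] at hfe
    simp only [Max4PC, of_apply, Matrix.sum_apply, Matrix.add_apply, vecMulVec_apply,
      Finset.sum_add_distrib]
    linarith
  rw [hall]
  refine (Fintype.sum_of_injective _ Subtype.val_injective _ _ (fun v hv => ?_) fun v => rfl).symm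
  have hleaf : T.degree v = 1 := by simpa using hv
  have hvr : v ≠ r := by
    rintro rfl
    exact hr hleaf
  rw [meetVec_eq_zero_of_degree_eq_one hT hleaf hvr, zero_vecMulVec, vecMulVec_zero, add_zero]

end Pairs

section PairRelation

variable {V R : Type*} [Fintype V] [DecidableEq V] [AddCommGroup R] {T : SimpleGraph V}
  {r p q v y : V} {a b : V → R}

/-- The function `a`, summed over the common ancestors of two distinct vertices, cancels the sums of
`b` over the ancestors of each. A linear relation between the vectors `meetVec T r v` and
`joinVec T r v` amounts to such a pair of functions. -/
def IsPairRelation (T : SimpleGraph V) (r : V) (a b : V → R) : Prop :=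
  ∀ ⦃x y⦄, x ≠ y → ∑ v ∈ ancestors T r x ∩ ancestors T r y, a v +
    (∑ v ∈ ancestors T r x, b v + ∑ v ∈ ancestors T r y, b v) = 0

namespace IsPairRelation

/-- The relations for the pairs `{y, q}` and `{p, q}` differ by `b y` only. -/
theorem right_eq_zero_of_isParent (h : IsPairRelation T r a b) (hT : T.IsTree)
    (hp : IsParent T r p y) (hpq : p ≠ q) (hyq : y ∉ ancestors T r q) : b y = 0 := by
  have hy : y ≠ q := by
    rintro rfl
    exact hyq self_mem_ancestors
  have hpair := (h hy).trans (h hpq).symm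
  rwa [hp.ancestors_eq_insert hT, Finset.insert_inter_of_notMem hyq,
    Finset.sum_insert hp.notMem_ancestors, add_right_inj, add_left_inj, add_eq_right] at hpair

variable [Nontrivial V] [DecidableRel T.Adj]

theorem right_eq_zero (h : IsPairRelation T r a b) (hT : T.IsTree) (hr : T.degree r ≠ 1)
    (hy : y ≠ r) : b y = 0 := by
  obtain ⟨p, hp⟩ := exists_isParent hT.connected hy
  suffices ∃ q, p ≠ q ∧ y ∉ ancestors T r q by
    obtain ⟨q, hpq, hyq⟩ := this
    exact h.right_eq_zero_of_isParent hT hp hpq hyq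
  by_cases hpr : p = r
  · obtain ⟨x, hxy, hx⟩ : ∃ x, x ≠ y ∧ IsParent T r r x := by
      obtain ⟨c, d, hcd, hc, hd⟩ := exists_ne_isParent_root hT hr
      by_cases hcy : c = y
      exacts [⟨d, hcy ▸ hcd.symm, hd⟩, ⟨c, hcy, hc⟩]
    refine ⟨x, hpr ▸ hx.ne_root.symm, ?_⟩
    simp [hx.ancestors_eq_insert hT, ancestors_root hT.connected, hxy.symm, hy]
  · exact ⟨r, hpr, by simpa [ancestors_root hT.connected] using hy⟩

theorem sum_ancestors_right (h : IsPairRelation T r a b) (hT : T.IsTree) (hr : T.degree r ≠ 1)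
    (x : V) : ∑ v ∈ ancestors T r x, b v = b r :=
  Finset.sum_eq_single_of_mem r root_mem_ancestors fun _ _ hv => h.right_eq_zero hT hr hv

theorem sum_ancestors_left_add_eq_zero (h : IsPairRelation T r a b) (hT : T.IsTree)
    (hr : T.degree r ≠ 1) (hv : T.degree v ≠ 1) : ∑ u ∈ ancestors T r v, a u + (b r + b r) = 0 := by
  obtain ⟨y, hy⟩ := exists_isParent_of_degree_ne_one hT hv r
  have hinter : ancestors T r y ∩ ancestors T r v = ancestors T r v := by
    rw [hy.ancestors_eq_insert hT]
    exact Finset.inter_eq_right.2 (Finset.subset_insert ..)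
  simpa only [hinter, h.sum_ancestors_right hT hr] using h hy.1.ne'

theorem left_root_add_eq_zero (h : IsPairRelation T r a b) (hT : T.IsTree) (hr : T.degree r ≠ 1) :
    a r + (b r + b r) = 0 := by
  simpa only [ancestors_root hT.connected, Finset.sum_singleton] using
    h.sum_ancestors_left_add_eq_zero hT hr hr

theorem left_eq_zero (h : IsPairRelation T r a b) (hT : T.IsTree) (hr : T.degree r ≠ 1)
    (hv : T.degree v ≠ 1) (hvr : v ≠ r) : a v = 0 := by
  obtain ⟨p, hp⟩ := exists_isParent hT.connected hvr
  have hpdeg : T.degree p ≠ 1 := by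
    by_cases hpr : p = r
    exacts [hpr ▸ hr, hp.degree_ne_one hT.connected hpr]
  have hsum := (h.sum_ancestors_left_add_eq_zero hT hr hv).trans
    (h.sum_ancestors_left_add_eq_zero hT hr hpdeg).symm
  rwa [hp.ancestors_eq_insert hT, Finset.sum_insert hp.notMem_ancestors, add_left_inj,
    add_eq_right] at hsum

end IsPairRelation
end PairRelation

section LinearIndependence

theorem sum_dite_smul {ι R M : Type*} [Fintype ι] [Semiring R] [AddCommMonoid M] [Module R M]
    {s : ι → Prop} [DecidablePred s] (c : {i // s i} → R) (u : ι → M) :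
    ∑ i, (if h : s i then c ⟨i, h⟩ else 0) • u i = ∑ i : {i // s i}, c i • u i := by
  refine (Fintype.sum_of_injective _ Subtype.val_injective _ _ (fun i hi => ?_) fun i => ?_).symm
  · rw [dif_neg (by simpa using hi), zero_smul]
  · rw [dif_pos i.2]

variable {V : Type*} [Fintype V] [DecidableEq V] {T : SimpleGraph V} {r : V}

theorem isPairRelation_of_sum_eq_zero {α β : V → ℝ}
    (h : ∑ v, α v • meetVec T r v + ∑ v, β v • joinVec T r v = 0) :
    IsPairRelation T r (fun v => α v + 2 * β v) fun v => β r - 2 * β v := by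
  intro x y hxy
  have hpair := congrFun h ⟨s(x, y), hxy⟩
  have hunion := Finset.sum_union_inter (s₁ := ancestors T r x) (s₂ := ancestors T r y) (f := β)
  have hcard : ((ancestors T r x ∩ ancestors T r y).card : ℝ) +
      (ancestors T r x ∪ ancestors T r y).card = (ancestors T r x).card + (ancestors T r y).card :=
    mod_cast Finset.card_inter_add_card_union ..
  simp only [Pi.add_apply, Finset.sum_apply, Pi.smul_apply, smul_eq_mul, sum_mul_meetVec,
    sum_mul_joinVec, pairMeet_mk, pairJoin_mk, hcard, Pi.zero_apply] at hpair
  simp only [Finset.sum_add_distrib, Finset.sum_sub_distrib, ← Finset.mul_sum, Finset.sum_const,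
    nsmul_eq_mul]
  linear_combination hpair + 2 * hunion

theorem coefficients_eq_zero_of_sum_eq_zero [Nontrivial V] [DecidableRel T.Adj] (hT : T.IsTree)
    (hr : T.degree r ≠ 1) {α β : V → ℝ} (hβ : ∀ v, T.degree v = 1 → β v = 0)
    (h : ∑ v, α v • meetVec T r v + ∑ v, β v • joinVec T r v = 0) :
    ∀ v, T.degree v ≠ 1 → α v = 0 ∧ β v = 0 := by
  have hrel := isPairRelation_of_sum_eq_zero h
  obtain ⟨l, hl⟩ := hT.exists_vert_degree_one_of_nontrivial
  have hlr : l ≠ r := by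
    rintro rfl
    exact hr hl
  have hβr : β r = 0 := by simpa [hβ l hl] using hrel.right_eq_zero hT hr hlr
  have hβ_zero : ∀ v, β v = 0 := fun v => by
    by_cases hv : v = r
    exacts [hv ▸ hβr, by simpa [hβr] using hrel.right_eq_zero hT hr hv]
  have hαr : α r = 0 := by simpa [hβr] using hrel.left_root_add_eq_zero hT hr
  refine fun v hv => ⟨?_, hβ_zero v⟩
  by_cases hvr : v = r
  exacts [hvr ▸ hαr, by simpa [hβ_zero v] using hrel.left_eq_zero hT hr hv hvr]

theorem linearIndependent_meetVec_joinVec [Nontrivial V] [DecidableRel T.Adj] (hT : T.IsTree)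
    (hr : T.degree r ≠ 1) :
    LinearIndependent ℝ (Sum.elim (fun v : {v // T.degree v ≠ 1} => meetVec T r v)
      fun v : {v // T.degree v ≠ 1} => joinVec T r v) := by
  refine Fintype.linearIndependent_iff.2 fun g hg => ?_
  let α : V → ℝ := fun v => if hv : T.degree v ≠ 1 then g (.inl ⟨v, hv⟩) else 0
  let β : V → ℝ := fun v => if hv : T.degree v ≠ 1 then g (.inr ⟨v, hv⟩) else 0
  have hsum : ∑ v, α v • meetVec T r v + ∑ v, β v • joinVec T r v = 0 := by
    rw [← hg, Fintype.sum_sum_type]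
    exact congrArg₂ (· + ·) (sum_dite_smul (g <| .inl ·) _) (sum_dite_smul (g <| .inr ·) _)
  have hzero := coefficients_eq_zero_of_sum_eq_zero hT hr (fun v hv => by simp [β, hv]) hsum
  rintro (⟨v, hv⟩ | ⟨v, hv⟩)
  exacts [by simpa [α, hv] using (hzero v hv).1, by simpa [β, hv] using (hzero v hv).2]

end LinearIndependence

theorem mainTheorem4 {V : Type*} [Fintype V] [DecidableEq V] (T : SimpleGraph V)
    [DecidableRel T.Adj] (hT : T.IsTree) (n p : ℕ) (hn : Fintype.card V = n) (hn3 : 3 ≤ n)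
    (hp : numLeaves T = p) :
    inertia (Max4PC_isHermitian T) = (n.choose 2 - 2 * (n - p), n - p, n - p) ∧
      Module.finrank ℝ (LinearMap.ker (Max4PC T).mulVecLin) = n.choose 2 - 2 * (n - p) := by
  have : Nontrivial V := Fintype.one_lt_card_iff_nontrivial.1 (by lia)
  obtain ⟨r, hr⟩ := exists_degree_ne_one hT (by lia)
  have hpairs : Fintype.card (VertexPair V) = n.choose 2 := by
    rw [Sym2.card_subtype_not_diag, hn]
  have hinner : Fintype.card {v // T.degree v ≠ 1} = n - p := by
    rw [Fintype.card_subtype_compl, hn, Fintype.card_subtype, ← hp, numLeaves]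
  have hinertia := inertia_of_eq_sum_vecMulVec (Max4PC_isHermitian T)
    (linearIndependent_meetVec_joinVec hT hr) (Max4PC_eq_sum_vecMulVec hT hr)
  rw [hpairs, hinner] at hinertia
  refine ⟨hinertia, ?_⟩
  rw [inertia_eq_finrank_ker_sigPos_sigNeg] at hinertia
  exact congrArg Prod.fst hinertia
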